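/- Let $M_n(\mathbb{C})$ carry the normalized inner product $\langle Y,X\rangle=\frac1n\mathrm{Tr}(Y^*X)$ and the normalized Schatten norms $\|X\|_{S_p}=\big(\frac1n\mathrm{Tr}[(X^*X)^{p/2}]\big)^{1/p}$ for $1\le p<\infty$, with $\|X\|_{S_\infty}$ the operator norm. For a superoperator, i.e. a linear map $\Phi:M_n(\mathbb{C})\to M_n(\mathbb{C})$, and $p,q\in[1,\infty]$ with $\frac1q+\frac1{q'}=1$, put $$\|\Phi\|_{S_p\to S_q}=\sup\{|\langle Y,\Phi(X)\rangle| : \|X\|_{S_p}\le 1,\ \|Y\|_{S_{q'}}\le 1\}.$$ Call $\Phi$ irreducibly covariant if there exist a compact (Hausdorff) group $\Gamma$ and continuous irreducible unitary representations $U,V:\Gamma\to U(n)$ such that $\Phi(U(g)XU(g)^*)=V(g)\Phi(X)V(g)^*$ for all $g\in\Gamma$ and $X\in M_n(\mathbb{C})$. Then for every $\varepsilon>0$ there exist a positive integer $n$ and a nonzero irreducibly covariant superoperator $\Phi:M_n(\mathbb{C})\to M_n(\mathbb{C})$ such that $$\|\Phi\|_{S_2\to S_2}\ \ge\ (2-\varepsilon)\,\|\Phi\|_{S_\infty\to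 S_1}.$$ Consequently the constant $2$ in the inequality $\|\Phi\|_{S_2\to S_2}\le 2\|\Phi\|_{S_\infty\to S_1}$ for irreducibly covariant superoperators cannot be improved: if $C\in\mathbb{R}$ is such that $\|\Phi\|_{S_2\to S_2}\le C\,\|\Phi\|_{S_\infty\to S_1}$ for every positive integer $n$ and every irreducibly covariant $\Phi:M_n(\mathbb{C})\to M_n(\mathbb{C})$, then $C\ge 2$. -/

import Mathlib

open scoped Matrix ENNReal

noncomputable section

/-- Superoperators on `M_n(ℂ)`: the linear maps from `M_n(ℂ)` to itself. -/
abbrev Superoperator (n : ℕ) : Type :=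
  Matrix (Fin n) (Fin n) ℂ →ₗ[ℂ] Matrix (Fin n) (Fin n) ℂ

/-- The normalized inner product `⟨y, x⟩ = (1/n) ∑ i, conj (y i) * x i` on `ℂⁿ`. -/
def vecInner {n : ℕ} (y x : Fin n → ℂ) : ℂ :=
  (n : ℂ)⁻¹ * ∑ i, star (y i) * x i

/-- The normalized `ℓ₂` norm `((1/n) ∑ i, |x i|²)^(1/2)` on `ℂⁿ`. -/
def ellTwoNorm {n : ℕ} (x : Fin n → ℂ) : ℝ :=
  Real.sqrt ((n : ℝ)⁻¹ * ∑ i, ‖x i‖ ^ 2)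

/-- The normalized inner product `⟨Y, X⟩ = (1/n) Tr(Y* X)` on `M_n(ℂ)`. -/
def matInner {n : ℕ} (Y X : Matrix (Fin n) (Fin n) ℂ) : ℂ :=
  (n : ℂ)⁻¹ * (Yᴴ * X).trace

/-- The normalized Schatten `p`-norm for `p ∈ [1, ∞]`: for finite `p` it is
`((1/n) Tr((X* X)^(p/2)))^(1/p)`, the power of the positive semidefinite matrix `X* X` being taken
by functional calculus; for `p = ∞` it is the operator norm
`sup {|⟨X x, y⟩| : ‖x‖_{ℓ₂} ≤ 1, ‖y‖_{ℓ₂} ≤ 1}`. -/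
def schattenNorm {n : ℕ} (p : ℝ≥0∞) (X : Matrix (Fin n) (Fin n) ℂ) : ℝ :=
  if p = ∞ then
    sSup {r : ℝ | ∃ x y : Fin n → ℂ,
      ellTwoNorm x ≤ 1 ∧ ellTwoNorm y ≤ 1 ∧ r = ‖vecInner (X *ᵥ x) y‖}
  else
    ((n : ℝ)⁻¹ * (cfc (fun t : ℝ => t ^ (p.toReal / 2)) (Xᴴ * X)).trace.re) ^ (1 / p.toReal)

/-- The norm `‖Φ‖_{S_p → S_q} = sup {|⟨Y, Φ X⟩| : ‖X‖_{S_p} ≤ 1, ‖Y‖_{S_q'} ≤ 1}`, where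
`1/q + 1/q' = 1`. -/
def superNorm {n : ℕ} (p q : ℝ≥0∞) (Φ : Superoperator n) : ℝ :=
  sSup {r : ℝ | ∃ X Y : Matrix (Fin n) (Fin n) ℂ,
    schattenNorm p X ≤ 1 ∧ schattenNorm (ENNReal.conjExponent q) Y ≤ 1 ∧
      r = ‖matInner Y (Φ X)‖}

/-- A unitary representation of `Γ` on `ℂⁿ` is irreducible if its only invariant subspaces are
`0` and `ℂⁿ`. -/
def IsIrreducibleRep {n : ℕ} {Γ : Type*} [Group Γ]
    (U : Γ →* Matrix.unitaryGroup (Fin n) ℂ) : Prop :=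
  ∀ W : Submodule ℂ (Fin n → ℂ),
    (∀ g : Γ, ∀ w ∈ W, (U g : Matrix (Fin n) (Fin n) ℂ) *ᵥ w ∈ W) → W = ⊥ ∨ W = ⊤

/-- `Φ` is irreducibly covariant if there are a compact (Hausdorff) group `Γ` and continuous
irreducible unitary representations `U, V` of `Γ` on `ℂⁿ` with
`Φ(U(g) X U(g)*) = V(g) Φ(X) V(g)*` for all `g` and `X`. -/
def IrreduciblyCovariant {n : ℕ} (Φ : Superoperator n) : Prop :=
  ∃ (Γ : Type) (_ : Group Γ) (_ : TopologicalSpace Γ) (_ : IsTopologicalGroup Γ)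
    (_ : CompactSpace Γ) (_ : T2Space Γ) (U V : Γ →* Matrix.unitaryGroup (Fin n) ℂ),
    Continuous U ∧ Continuous V ∧ IsIrreducibleRep U ∧ IsIrreducibleRep V ∧
      ∀ (g : Γ) (X : Matrix (Fin n) (Fin n) ℂ),
        Φ ((U g : Matrix (Fin n) (Fin n) ℂ) * X * (U g : Matrix (Fin n) (Fin n) ℂ)ᴴ) =
          (V g : Matrix (Fin n) (Fin n) ℂ) * Φ X * (V g : Matrix (Fin n) (Fin n) ℂ)ᴴ

end

/-! The example is a multiple of an orthogonal projection in matrix space. On the antisymmetric Fock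
space of `2n+1` modes, the Hodge star followed by an annihilation operator preserves the
`n`-particle sector, of dimension `d = (2n+1).choose n`. Let `c i` be the restriction of `annHodge
i` and `Φ X = ∑ i, ⟨c i, X⟩ c i`.

The `c i` are orthogonal with `⟨c i, c i⟩ = κ = (n+1)/(2n+1)` (`trace_annHodge`), so `Φ` has
eigenvalue `κ` and its `S₂ → S₂` norm is at least `κ` (`le_superNorm_two_two`). The anticommutation
relations make every `C = ∑ i, v i • c i` a multiple of a partial isometry, `C Cᴴ C = |v|² C`, of
normalized trace norm `κ|v|`. Duality then bounds the coefficient vector of any `X` in the operator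
unit ball by `κ` (`sum_norm_matInner_le`), and the `S_∞ → S₁` norm by `κ²`. The ratio is at least
`1/κ = (2n+1)/(n+1)`, which tends to `2`.

Covariance holds because mode parities and second quantized transpositions permute the `c i` up to
sign under conjugation; these symmetries already act irreducibly on the sector
(`Fock.irreduciblyCovariant`). -/

namespace Fock

/-! ### Antisymmetric Fock space: anticommutation relations and the Hodge star. -/

variable {ι : Type*} [Fintype ι] [LinearOrder ι]

/-- The sign `(-1)^#{j ∈ S | j < i}`. -/
def sgn (i : ι) (S : Finset ι) : ℂ := ∏ j ∈ S, if j < i then -1 else 1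

/-- The annihilation operator of the mode `i`, on the antisymmetric Fock space whose standard
basis is indexed by the finite sets of modes. -/
def ann (i : ι) : Matrix (Finset ι) (Finset ι) ℂ :=
  Matrix.of fun S T => if i ∉ S ∧ T = insert i S then sgn i S else 0

/-- The sign occurring in the Hodge star operator. -/
def hodgeSign (S : Finset ι) : ℂ := ∏ j ∈ S, sgn j Finset.univ

/-- The Hodge star operator, with signs chosen so that it intertwines annihilation and creation. -/
def hodge : Matrix (Finset ι) (Finset ι) ℂ :=
  Matrix.of fun S T => if T = Sᶜ then hodgeSign S else 0

omit [Fintype ι] in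
lemma sgn_mul_self (i : ι) (S : Finset ι) : sgn i S * sgn i S = 1 := by
  rw [sgn, ← Finset.prod_mul_distrib]
  exact Finset.prod_eq_one fun j _ => by split_ifs <;> norm_num

omit [Fintype ι] in
lemma star_sgn (i : ι) (S : Finset ι) : star (sgn i S) = sgn i S := by
  rw [sgn, star_prod]
  exact Finset.prod_congr rfl fun j _ => by split_ifs <;> simp

omit [Fintype ι] in
lemma sgn_insert {i j : ι} {S : Finset ι} (h : j ∉ S) :
    sgn i (insert j S) = (if j < i then -1 else 1) * sgn i S := by
  rw [sgn, Finset.prod_insert h, sgn]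

omit [Fintype ι] in
lemma sgn_erase {i j : ι} {S : Finset ι} (h : j ∈ S) :
    sgn i (S.erase j) = (if j < i then -1 else 1) * sgn i S := by
  rw [sgn, sgn, ← Finset.mul_prod_erase S _ h, ← mul_assoc]
  split_ifs <;> simp

lemma sgn_mul_sgn_compl (i : ι) (S : Finset ι) : sgn i S * sgn i Sᶜ = sgn i Finset.univ :=
  Finset.prod_mul_prod_compl S _

lemma hodgeSign_mul_self (S : Finset ι) : hodgeSign S * hodgeSign S = 1 := by
  rw [hodgeSign, ← Finset.prod_mul_distrib]
  exact Finset.prod_eq_one fun j _ => sgn_mul_self _ _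

lemma star_hodgeSign (S : Finset ι) : star (hodgeSign S) = hodgeSign S := by
  rw [hodgeSign, star_prod]
  exact Finset.prod_congr rfl fun j _ => star_sgn _ _

lemma hodgeSign_insert {j : ι} {S : Finset ι} (h : j ∉ S) :
    hodgeSign (insert j S) = sgn j Finset.univ * hodgeSign S := by
  rw [hodgeSign, Finset.prod_insert h, hodgeSign]

lemma hodgeSign_erase {j : ι} {S : Finset ι} (h : j ∈ S) :
    hodgeSign (S.erase j) = sgn j Finset.univ * hodgeSign S := by
  rw [hodgeSign, hodgeSign, ← Finset.mul_prod_erase S _ h, ← mul_assoc, sgn_mul_self, one_mul]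

lemma ann_mulVec (i : ι) (f : Finset ι → ℂ) (S : Finset ι) :
    (ann i *ᵥ f) S = if i ∈ S then 0 else sgn i S * f (insert i S) := by
  by_cases h : i ∈ S <;> simp [Matrix.mulVec, dotProduct, ann, h]

lemma ann_conjTranspose_mulVec (i : ι) (f : Finset ι → ℂ) (S : Finset ι) :
    ((ann i)ᴴ *ᵥ f) S = if i ∈ S then sgn i S * f (S.erase i) else 0 := by
  have key : ∀ T : Finset ι, (i ∉ T ∧ S = insert i T) ↔ (i ∈ S ∧ T = S.erase i) := by
    intro T
    constructor
    · rintro ⟨h, rfl⟩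
      simp [h]
    · rintro ⟨h, rfl⟩
      simp [h]
  simp only [Matrix.mulVec, dotProduct, Matrix.conjTranspose_apply, ann, Matrix.of_apply, key]
  by_cases h : i ∈ S
  · simp only [h, true_and, if_true]
    rw [Finset.sum_eq_single (S.erase i)]
    · have := star_sgn i (S.erase i)
      rw [if_pos rfl, this, sgn_erase h]; simp
    · intro T _ hT; simp [hT]
    · simp
  · simp [h]

lemma hodge_mulVec (f : Finset ι → ℂ) (S : Finset ι) :
    ((hodge : Matrix (Finset ι) (Finset ι) ℂ) *ᵥ f) S = hodgeSign S * f Sᶜ := by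
  simp [Matrix.mulVec, dotProduct, hodge]

lemma hodge_conjTranspose_mulVec (f : Finset ι → ℂ) (S : Finset ι) :
    ((hodge : Matrix (Finset ι) (Finset ι) ℂ)ᴴ *ᵥ f) S = hodgeSign Sᶜ * f Sᶜ := by
  simp only [Matrix.mulVec, dotProduct, Matrix.conjTranspose_apply, hodge, Matrix.of_apply]
  rw [Finset.sum_eq_single Sᶜ]
  · rw [compl_compl, if_pos rfl, star_hodgeSign]
  · intro T _ hT
    rw [if_neg, star_zero, zero_mul]
    rintro rfl
    simp at hT
  · simp

omit [LinearOrder ι] in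
lemma matrix_ext {M M' : Matrix (Finset ι) (Finset ι) ℂ}
    (h : ∀ f S, (M *ᵥ f) S = (M' *ᵥ f) S) : M = M' := by
  classical
  exact Matrix.ext_of_mulVec_single fun T => funext fun S => h _ S

/-- For `i ≠ j` exactly one of `i < j` and `j < i` holds, so exactly one of the two orders of
removal picks up an extra sign. -/
lemma ann_mul_ann_add (i j : ι) : ann i * ann j + ann j * ann i = 0 := by
  refine matrix_ext fun f S => ?_
  simp only [Matrix.add_mulVec, Pi.add_apply, ← Matrix.mulVec_mulVec, ann_mulVec,
    Matrix.zero_mulVec, Pi.zero_apply]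
  rcases eq_or_ne i j with rfl | hij
  · simp
  by_cases hi : i ∈ S <;> by_cases hj : j ∈ S <;> simp [hi, hj, hij, hij.symm]
  rw [sgn_insert hi, sgn_insert hj, Finset.insert_comm]
  rcases lt_or_gt_of_ne hij with h | h <;> simp [h, h.not_gt] <;> ring

lemma ann_mul_conjTranspose_add (i j : ι) :
    ann i * (ann j)ᴴ + (ann j)ᴴ * ann i = if i = j then 1 else 0 := by
  refine matrix_ext fun f S => ?_
  simp only [Matrix.add_mulVec, Pi.add_apply, ← Matrix.mulVec_mulVec, ann_mulVec,
    ann_conjTranspose_mulVec]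
  rcases eq_or_ne i j with rfl | hij
  · by_cases hi : i ∈ S
    · simp [hi, sgn_erase hi, ← mul_assoc, sgn_mul_self]
    · simp [hi, sgn_insert hi, ← mul_assoc, sgn_mul_self]
  by_cases hi : i ∈ S <;> by_cases hj : j ∈ S <;> simp [hi, hj, hij, hij.symm]
  rw [sgn_insert hi, sgn_erase hj, Finset.erase_insert_of_ne hij]
  rcases lt_or_gt_of_ne hij with h | h <;> simp [h, h.not_gt] <;> ring

lemma hodge_mul_conjTranspose :
    (hodge : Matrix (Finset ι) (Finset ι) ℂ) * hodgeᴴ = 1 := by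
  refine matrix_ext fun f S => ?_
  simp [← Matrix.mulVec_mulVec, hodge_mulVec, hodge_conjTranspose_mulVec, ← mul_assoc,
    hodgeSign_mul_self]

/-- Complementation exchanges adding and removing a mode. The signs match because `sgn i S * sgn i
Sᶜ` is `sgn i univ`, the factor by which `hodgeSign` changes when `i` is added or removed. -/
lemma hodge_mul_ann (i : ι) : hodge * ann i = (ann i)ᴴ * hodge := by
  refine matrix_ext fun f S => ?_
  simp only [← Matrix.mulVec_mulVec, hodge_mulVec, ann_mulVec, ann_conjTranspose_mulVec]
  by_cases hi : i ∈ S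
  · simp [hi, hodgeSign_erase hi, ← sgn_mul_sgn_compl i S]
    linear_combination (- hodgeSign S * sgn i Sᶜ * f (insert i Sᶜ)) * sgn_mul_self i S
  · simp [hi]

lemma hodge_mul_conjTranspose_ann (i : ι) : hodge * (ann i)ᴴ = ann i * hodge := by
  refine matrix_ext fun f S => ?_
  simp only [← Matrix.mulVec_mulVec, hodge_mulVec, ann_mulVec, ann_conjTranspose_mulVec]
  by_cases hi : i ∈ S
  · simp [hi]
  · simp [hi, hodgeSign_insert hi, ← sgn_mul_sgn_compl i S]
    linear_combination (- hodgeSign S * sgn i Sᶜ * f (Sᶜ.erase i)) * sgn_mul_self i S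

/-! ### The operators `annHodge` and their symmetries. -/

/-- The annihilation operator composed with the Hodge star operator. -/
def annHodge (i : ι) : Matrix (Finset ι) (Finset ι) ℂ := ann i * hodge

/-- The parity of the mode `i`. -/
def parity (i : ι) : Matrix (Finset ι) (Finset ι) ℂ := 1 - (2 : ℂ) • ((ann i)ᴴ * ann i)

/-- The second quantization of the transposition of the modes `i` and `j`. -/
def swap (i j : ι) : Matrix (Finset ι) (Finset ι) ℂ :=
  1 - (ann i - ann j)ᴴ * (ann i - ann j)

lemma parity_mulVec (i : ι) (f : Finset ι → ℂ) (S : Finset ι) :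
    (parity i *ᵥ f) S = (if i ∈ S then -1 else 1) * f S := by
  simp only [parity, Matrix.sub_mulVec, Pi.sub_apply, Matrix.smul_mulVec, Pi.smul_apply,
    ← Matrix.mulVec_mulVec, ann_mulVec, ann_conjTranspose_mulVec, Matrix.one_mulVec]
  by_cases hi : i ∈ S
  · simp [hi, sgn_erase hi, ← mul_assoc, sgn_mul_self]; ring
  · simp [hi]

lemma swap_mulVec {i j : ι} (f : Finset ι → ℂ) {S : Finset ι} (hi : i ∈ S) (hj : j ∉ S) :
    (swap i j *ᵥ f) S = sgn i S * sgn j (S.erase i) * f (insert j (S.erase i)) := by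
  simp [swap, Matrix.sub_mulVec, Pi.sub_apply, Matrix.sub_mul, Matrix.mul_sub,
    ← Matrix.mulVec_mulVec, ann_mulVec, ann_conjTranspose_mulVec, hi, hj, sgn_erase hi,
    ← mul_assoc, sgn_mul_self]

lemma parity_isHermitian (i : ι) : (parity i)ᴴ = parity i := by
  simp [parity, Matrix.conjTranspose_mul]

lemma swap_isHermitian (i j : ι) : (swap i j)ᴴ = swap i j := by
  simp [swap, Matrix.conjTranspose_mul]

lemma parity_mul_self (i : ι) : parity i * parity i = 1 := by
  refine matrix_ext fun f S => ?_
  simp only [← Matrix.mulVec_mulVec, parity_mulVec, Matrix.one_mulVec]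
  split_ifs <;> ring

lemma ann_mul_self (i : ι) : ann i * ann i = 0 := by
  refine matrix_ext fun f S => ?_
  simp [← Matrix.mulVec_mulVec, ann_mulVec]

lemma parity_mul_ann (i j : ι) :
    parity i * ann j = (if i = j then (-1 : ℂ) else 1) • (ann j * parity i) := by
  refine matrix_ext fun f S => ?_
  rcases eq_or_ne i j with rfl | hij
  · simp only [← Matrix.mulVec_mulVec, parity_mulVec, ann_mulVec, if_true, Matrix.smul_mulVec,
      Pi.smul_apply]
    by_cases hi : i ∈ S <;> simp [hi]
  · simp only [← Matrix.mulVec_mulVec, parity_mulVec, ann_mulVec, hij, if_false,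
      Matrix.smul_mulVec, Pi.smul_apply]
    by_cases hi : i ∈ S <;> by_cases hj : j ∈ S <;> simp [hi, hj, hij]

lemma parity_mul_hodge (i : ι) :
    parity i * hodge = - (hodge * parity i) := by
  refine matrix_ext fun f S => ?_
  simp only [← Matrix.mulVec_mulVec, parity_mulVec, hodge_mulVec, Matrix.neg_mulVec, Pi.neg_apply]
  by_cases hi : i ∈ S <;> simp [hi]

/-- Passing the Hodge star always costs a sign, since it exchanges occupied and empty modes; passing
`ann j` costs one only for `j = i`. -/
lemma parity_mul_annHodge (i j : ι) :
    parity i * annHodge j = (if i = j then (1 : ℂ) else -1) • (annHodge j * parity i) := by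
  rw [annHodge, ← mul_assoc, parity_mul_ann, smul_mul_assoc, mul_assoc, parity_mul_hodge]
  split_ifs <;> simp [mul_assoc]

/-! ### Second quantized transpositions. -/

section Swap

variable {i j : ι}

lemma sub_mul_sub_self (i j : ι) : (ann i - ann j) * (ann i - ann j) = 0 := by
  have h := ann_mul_ann_add i j
  simp only [sub_mul, mul_sub, ann_mul_self, sub_zero, zero_sub, eq_neg_of_add_eq_zero_left h,
    sub_self]

/-- With `b = ann i - ann j`, this and `b² = 0` make `bᴴ b / 2` a projection, so that `swap i j = 1
- bᴴ b` is a reflection. -/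
lemma sub_mul_conjTranspose_add (hij : i ≠ j) :
    (ann i - ann j) * (ann i - ann j)ᴴ + (ann i - ann j)ᴴ * (ann i - ann j) = 2 := by
  have h1 := ann_mul_conjTranspose_add i i
  have h2 := ann_mul_conjTranspose_add j j
  have h3 := ann_mul_conjTranspose_add i j
  have h4 := ann_mul_conjTranspose_add j i
  simp only [if_true, hij, hij.symm, if_false] at h1 h2 h3 h4
  have h : (2 : Matrix (Finset ι) (Finset ι) ℂ) = 1 + 1 - 0 - 0 := by norm_num
  rw [h]
  nth_rewrite 1 [← h1]
  rw [← h2]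
  nth_rewrite 1 [← h3]
  rw [← h4]
  simp only [Matrix.conjTranspose_sub, sub_mul, mul_sub]
  abel

lemma swap_mul_self (hij : i ≠ j) : swap i j * swap i j = 1 := by
  have h1 := sub_mul_sub_self i j
  have h2 := eq_sub_of_add_eq (sub_mul_conjTranspose_add hij)
  simp only [swap]
  generalize ann i - ann j = b at *
  have : bᴴ * b * (bᴴ * b) = 2 * (bᴴ * b) := by
    rw [mul_assoc, ← mul_assoc b, h2, sub_mul, mul_sub, mul_assoc bᴴ b b, h1]
    simp [two_mul, mul_add]
  rw [sub_mul, mul_sub, mul_sub, this, two_mul]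
  simp

lemma swap_mul_sub (i j : ι) : swap i j * (ann i - ann j) = ann i - ann j := by
  rw [swap, sub_mul, mul_assoc, sub_mul_sub_self]
  simp

lemma sub_mul_swap (hij : i ≠ j) : (ann i - ann j) * swap i j = - (ann i - ann j) := by
  have h1 := sub_mul_sub_self i j
  have h2 := eq_sub_of_add_eq (sub_mul_conjTranspose_add hij)
  rw [swap]
  generalize ann i - ann j = b at *
  rw [mul_sub, ← mul_assoc, h2, sub_mul, mul_assoc _ b b, h1]
  simp [two_mul]

/-- An operator anticommuting with `bᴴ` and `b` commutes with `1 - bᴴ b`. -/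
lemma one_sub_mul_comm {b c : Matrix (Finset ι) (Finset ι) ℂ} (h : b * c + c * b = 0)
    (h' : bᴴ * c + c * bᴴ = 0) : (1 - bᴴ * b) * c = c * (1 - bᴴ * b) := by
  rw [sub_mul, mul_sub, one_mul, mul_one, mul_assoc, eq_neg_of_add_eq_zero_left h, mul_neg,
    ← mul_assoc, eq_neg_of_add_eq_zero_left h', neg_mul, neg_neg, mul_assoc]

lemma swap_mul_ann_of_ne {k : ι} (hi : k ≠ i) (hj : k ≠ j) :
    swap i j * ann k = ann k * swap i j := by
  apply one_sub_mul_comm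
  · have h := ann_mul_ann_add i k
    have h' := ann_mul_ann_add j k
    rw [← sub_zero (0 : Matrix (Finset ι) (Finset ι) ℂ)]
    nth_rewrite 1 [← h]
    rw [← h', sub_mul, mul_sub]
    abel
  · have h := ann_mul_conjTranspose_add k i
    have h' := ann_mul_conjTranspose_add k j
    simp only [hi, hj, if_false] at h h'
    rw [← sub_zero (0 : Matrix (Finset ι) (Finset ι) ℂ)]
    nth_rewrite 1 [← h]
    rw [← h', Matrix.conjTranspose_sub, sub_mul, mul_sub]
    abel

/-- The mode vectors `(1, 1)` and `(1, -1)` are orthogonal, so `ann i + ann j` anticommutes with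
both `ann i - ann j` and its adjoint. -/
lemma swap_mul_add (hij : i ≠ j) :
    swap i j * (ann i + ann j) = (ann i + ann j) * swap i j := by
  apply one_sub_mul_comm
  · have h := ann_mul_ann_add i j
    simp only [sub_mul, mul_add, mul_sub, add_mul, ann_mul_self]
    abel
  · have h1 := ann_mul_conjTranspose_add i i
    have h2 := ann_mul_conjTranspose_add j j
    have h3 := ann_mul_conjTranspose_add i j
    have h4 := ann_mul_conjTranspose_add j i
    simp only [if_true, hij, hij.symm, if_false] at h1 h2 h3 h4
    have h : (0 : Matrix (Finset ι) (Finset ι) ℂ) = 1 - 1 - 0 + 0 := by simp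
    rw [h]
    nth_rewrite 1 [← h1]
    rw [← h2]
    nth_rewrite 1 [← h3]
    rw [← h4]
    simp only [Matrix.conjTranspose_sub, sub_mul, mul_sub, add_mul, mul_add]
    abel

/-- The swap commutes with the sum of the two annihilators and anticommutes with their difference.
-/
lemma swap_mul_ann_left (hij : i ≠ j) : swap i j * ann i = ann j * swap i j := by
  have e : ann i = (2 : ℂ)⁻¹ • ((ann i + ann j) + (ann i - ann j)) := by
    rw [add_add_sub_cancel, ← two_smul ℂ, smul_smul]; norm_num
  have e' : ann j = (2 : ℂ)⁻¹ • ((ann i + ann j) - (ann i - ann j)) := by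
    rw [add_sub_sub_cancel, ← two_smul ℂ, smul_smul]; norm_num
  have e₁ : swap i j * ann i = (2 : ℂ)⁻¹ • ((ann i + ann j) * swap i j + (ann i - ann j)) := by
    conv_lhs => rw [e]
    rw [mul_smul_comm, mul_add, swap_mul_add hij, swap_mul_sub]
  have e₂ : ann j * swap i j = (2 : ℂ)⁻¹ • ((ann i + ann j) * swap i j + (ann i - ann j)) := by
    conv_lhs => rw [e']
    rw [smul_mul_assoc, sub_mul, sub_mul_swap hij, sub_neg_eq_add]
  rw [e₁, e₂]

lemma swap_mul_ann (hij : i ≠ j) (k : ι) :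
    swap i j * ann k = ann (Equiv.swap i j k) * swap i j := by
  rcases eq_or_ne k i with rfl | hi
  · rw [Equiv.swap_apply_left, swap_mul_ann_left hij]
  rcases eq_or_ne k j with rfl | hj
  · rw [Equiv.swap_apply_right]
    have h := congrArg (fun M => swap i k * M * swap i k) (swap_mul_ann_left hij)
    simp only [mul_assoc, swap_mul_self hij, mul_one] at h
    simp only [← mul_assoc, swap_mul_self hij, one_mul] at h
    exact h.symm
  · rw [Equiv.swap_apply_of_ne_of_ne hi hj, swap_mul_ann_of_ne hi hj]

/-- Moving the Hodge star across turns `1 - bᴴ b` into `1 - b bᴴ`, which is `-(1 - bᴴ b)` because `b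
bᴴ + bᴴ b = 2`. -/
lemma swap_mul_hodge (hij : i ≠ j) : swap i j * hodge = - (hodge * swap i j) := by
  have h1 : (ann i - ann j) * hodge = hodge * (ann i - ann j)ᴴ := by
    rw [Matrix.conjTranspose_sub, sub_mul, mul_sub, hodge_mul_conjTranspose_ann,
      hodge_mul_conjTranspose_ann]
  have h2 : (ann i - ann j)ᴴ * hodge = hodge * (ann i - ann j) := by
    rw [Matrix.conjTranspose_sub, sub_mul, mul_sub, hodge_mul_ann, hodge_mul_ann]
  have h3 := eq_sub_of_add_eq (sub_mul_conjTranspose_add hij)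
  rw [swap]
  generalize ann i - ann j = b at *
  rw [sub_mul, mul_sub, mul_assoc, h1, ← mul_assoc, h2, mul_assoc, h3, mul_sub, mul_two,
    one_mul, mul_one]
  abel

lemma swap_mul_annHodge (hij : i ≠ j) (k : ι) :
    swap i j * annHodge k = - (annHodge (Equiv.swap i j k) * swap i j) := by
  rw [annHodge, ← mul_assoc, swap_mul_ann hij, mul_assoc, swap_mul_hodge hij, mul_neg, annHodge,
    mul_assoc]

end Swap

/-! ### Linear combinations as multiples of partial isometries. -/

/-- The combination `∑ i, v i • annHodge i`. -/
def annHodgeSum (v : ι → ℂ) : Matrix (Finset ι) (Finset ι) ℂ := ∑ i, v i • annHodge i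

lemma annHodgeSum_eq (v : ι → ℂ) : annHodgeSum v = (∑ i, v i • ann i) * hodge := by
  simp [annHodgeSum, annHodge, Finset.sum_mul]

lemma sum_ann_mul_self (v : ι → ℂ) : (∑ i, v i • ann i) * (∑ i, v i • ann i) = 0 := by
  have h : (∑ i, v i • ann i) * (∑ i, v i • ann i) + (∑ i, v i • ann i) * (∑ i, v i • ann i)
      = 0 := by
    simp only [Finset.sum_mul, Finset.mul_sum, smul_mul_assoc, mul_smul_comm, Finset.smul_sum]
    nth_rewrite 2 [Finset.sum_comm]
    simp only [← Finset.sum_add_distrib]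
    refine Finset.sum_eq_zero fun i _ => Finset.sum_eq_zero fun j _ => ?_
    rw [smul_comm (v j), ← smul_add, ← smul_add, add_comm, ann_mul_ann_add, smul_zero, smul_zero]
  rw [← two_smul ℂ] at h
  exact (smul_eq_zero.1 h).resolve_left two_ne_zero

lemma sum_ann_mul_conjTranspose_add (v : ι → ℂ) :
    (∑ i, v i • ann i) * (∑ i, v i • ann i)ᴴ + (∑ i, v i • ann i)ᴴ * (∑ i, v i • ann i)
      = (∑ i, v i * star (v i)) • 1 := by
  simp only [Matrix.conjTranspose_sum, Matrix.conjTranspose_smul]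
  simp only [Finset.sum_mul, Finset.mul_sum, smul_mul_assoc, mul_smul_comm, Finset.smul_sum]
  rw [Finset.sum_comm]
  simp only [← Finset.sum_add_distrib]
  simp only [smul_comm (v _) (star (v _)), ← smul_add]
  rw [Finset.sum_comm]
  simp only [ann_mul_conjTranspose_add]
  simp [Finset.sum_smul, smul_smul, mul_comm]

/-- The Hodge star is unitary and cancels in the middle. For `b = ∑ i, v i • ann i`, replacing `b
bᴴ` by `|v|² - bᴴ b` in `b bᴴ b` leaves `|v|² b`, as `b² = 0`. -/
lemma annHodgeSum_mul_conjTranspose (v : ι → ℂ) :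
    annHodgeSum v * (annHodgeSum v)ᴴ * annHodgeSum v
      = (∑ i, v i * star (v i)) • annHodgeSum v := by
  simp only [annHodgeSum_eq]
  have h1 := sum_ann_mul_self v
  have h2 := sum_ann_mul_conjTranspose_add v
  generalize ∑ i, v i • ann i = b at *
  rw [Matrix.conjTranspose_mul, ← mul_assoc, ← mul_assoc, mul_assoc b, hodge_mul_conjTranspose,
    mul_one, eq_sub_of_add_eq h2, sub_mul, mul_assoc bᴴ, h1]
  simp

end Fock

/-! ### Superoperators built from a family of matrices, and their symmetry groups. -/

lemma matInner_conj {d : ℕ} (C X U : Matrix (Fin d) (Fin d) ℂ) :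
    matInner C (U * X * Uᴴ) = matInner (Uᴴ * C * U) X := by
  simp only [matInner, Matrix.conjTranspose_mul, Matrix.conjTranspose_conjTranspose]
  rw [← mul_assoc, Matrix.trace_mul_comm]
  simp only [mul_assoc]

/-- The superoperator `X ↦ ∑ i, ⟨c i, X⟩ c i`. -/
noncomputable def spanSuperoperator {ι : Type*} [Fintype ι] {d : ℕ}
    (c : ι → Matrix (Fin d) (Fin d) ℂ) :
    Superoperator d where
  toFun X := ∑ i, matInner (c i) X • c i
  map_add' X Y := by
    simp [matInner, mul_add, add_smul, Finset.sum_add_distrib]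
  map_smul' a X := by
    simp [matInner, Finset.smul_sum, smul_smul, mul_left_comm]

lemma spanSuperoperator_apply {ι : Type*} [Fintype ι] {d : ℕ}
    (c : ι → Matrix (Fin d) (Fin d) ℂ) (X : Matrix (Fin d) (Fin d) ℂ) :
    spanSuperoperator c X = ∑ i, matInner (c i) X • c i := rfl

/-- The group of the unitaries whose conjugation commutes with a superoperator. -/
def superoperatorSymmetry {d : ℕ} (Φ : Superoperator d) :
    Subgroup (Matrix.unitaryGroup (Fin d) ℂ) where
  carrier := {U | ∀ X, Φ ((U : Matrix (Fin d) (Fin d) ℂ) * X * (U : Matrix (Fin d) (Fin d) ℂ)ᴴ) =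
    (U : Matrix (Fin d) (Fin d) ℂ) * Φ X * (U : Matrix (Fin d) (Fin d) ℂ)ᴴ}
  one_mem' X := by simp
  mul_mem' {U V} hU hV X := by
    have h := hU ((V : Matrix (Fin d) (Fin d) ℂ) * X * (V : Matrix (Fin d) (Fin d) ℂ)ᴴ)
    rw [hV] at h
    simpa [mul_assoc, Matrix.conjTranspose_mul] using h
  inv_mem' {U} hU X := by
    have h1 : (U : Matrix (Fin d) (Fin d) ℂ)ᴴ * U = 1 := Matrix.mem_unitaryGroup_iff'.1 U.2
    have h2 : (U : Matrix (Fin d) (Fin d) ℂ) * (U : Matrix (Fin d) (Fin d) ℂ)ᴴ = 1 :=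
      Matrix.mem_unitaryGroup_iff.1 U.2
    have h3 : ((U⁻¹ : Matrix.unitaryGroup (Fin d) ℂ) : Matrix (Fin d) (Fin d) ℂ)
      = (U : Matrix (Fin d) (Fin d) ℂ)ᴴ := rfl
    have h := hU ((U : Matrix (Fin d) (Fin d) ℂ)ᴴ * X * U)
    have e : (U : Matrix (Fin d) (Fin d) ℂ) * ((U : Matrix (Fin d) (Fin d) ℂ)ᴴ * X * U) *
        (U : Matrix (Fin d) (Fin d) ℂ)ᴴ = X := by
      rw [mul_assoc, mul_assoc, h2, mul_one, ← mul_assoc, h2, one_mul]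
    rw [e] at h
    rw [h3, Matrix.conjTranspose_conjTranspose, h]
    generalize Φ ((U : Matrix (Fin d) (Fin d) ℂ)ᴴ * X * U) = Y
    simp only [mul_assoc]
    rw [h1, mul_one, ← mul_assoc, h1, one_mul]

lemma isCompact_unitaryGroup (d : ℕ) :
    IsCompact (Matrix.unitaryGroup (Fin d) ℂ : Set (Matrix (Fin d) (Fin d) ℂ)) := by
  have hK : IsCompact (Set.univ.pi fun _ : Fin d => Set.univ.pi fun _ : Fin d =>
      Metric.closedBall (0 : ℂ) 1) :=
    isCompact_univ_pi fun _ => isCompact_univ_pi fun _ => isCompact_closedBall _ _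
  refine IsCompact.of_isClosed_subset hK ?_ ?_
  · have : (Matrix.unitaryGroup (Fin d) ℂ : Set (Matrix (Fin d) (Fin d) ℂ))
        = {U | U * star U = 1} := Set.ext fun U => Matrix.mem_unitaryGroup_iff
    rw [this]
    exact isClosed_eq (by fun_prop) continuous_const
  · intro U hU i _ j _
    simpa using entry_norm_bound_of_unitary hU i j

lemma compactSpace_superoperatorSymmetry {d : ℕ} (Φ : Superoperator d) :
    CompactSpace (superoperatorSymmetry Φ) := by
  have : CompactSpace (Matrix.unitaryGroup (Fin d) ℂ) :=
    isCompact_iff_compactSpace.1 (isCompact_unitaryGroup d)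
  have hΦ : Continuous Φ := Φ.continuous_of_finiteDimensional
  have : IsClosed (superoperatorSymmetry Φ : Set (Matrix.unitaryGroup (Fin d) ℂ)) := by
    have : (superoperatorSymmetry Φ : Set (Matrix.unitaryGroup (Fin d) ℂ)) = ⋂ X,
      {U : Matrix.unitaryGroup (Fin d) ℂ |
      Φ ((U : Matrix (Fin d) (Fin d) ℂ) * X * (U : Matrix (Fin d) (Fin d) ℂ)ᴴ) =
        (U : Matrix (Fin d) (Fin d) ℂ) * Φ X * (U : Matrix (Fin d) (Fin d) ℂ)ᴴ} := by
      ext U; simp [superoperatorSymmetry]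
    rw [this]
    exact isClosed_iInter fun X => isClosed_eq (by fun_prop) (by fun_prop)
  exact isCompact_iff_compactSpace.1 this.isCompact

/-- The symmetry group is closed in the unitary group, hence compact; it serves as `Γ`, with both
representations the inclusion. -/
lemma irreduciblyCovariant_of_symmetry {d : ℕ} (Φ : Superoperator d)
    (h : ∀ W : Submodule ℂ (Fin d → ℂ), (∀ U ∈ superoperatorSymmetry Φ, ∀ w ∈ W,
      (U : Matrix (Fin d) (Fin d) ℂ) *ᵥ w ∈ W) → W = ⊥ ∨ W = ⊤) :
    IrreduciblyCovariant Φ := by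
  have hirr : IsIrreducibleRep (superoperatorSymmetry Φ).subtype :=
    fun W hW => h W fun U hU w hw => hW ⟨U, hU⟩ w hw
  exact ⟨superoperatorSymmetry Φ, inferInstance, inferInstance, inferInstance,
    compactSpace_superoperatorSymmetry Φ, inferInstance, (superoperatorSymmetry Φ).subtype,
    (superoperatorSymmetry Φ).subtype, continuous_subtype_val, continuous_subtype_val, hirr, hirr,
    fun g X => g.2 X⟩

/-- A unitary permuting the `c i` up to signs is a symmetry of `spanSuperoperator c`. -/
lemma mem_superoperatorSymmetry {ι : Type*} [Fintype ι] {d : ℕ}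
    {c : ι → Matrix (Fin d) (Fin d) ℂ} {U : Matrix.unitaryGroup (Fin d) ℂ} (σ : Equiv.Perm ι)
    (s : ι → ℂ) (hs : ∀ i, star (s i) = s i)
    (h : ∀ i, (U : Matrix (Fin d) (Fin d) ℂ) * c (σ i) = s i • (c i * U))
    (hs' : ∀ i, s i * s i = 1) :
    U ∈ superoperatorSymmetry (spanSuperoperator c) := by
  intro X
  have h1 : (U : Matrix (Fin d) (Fin d) ℂ)ᴴ * U = 1 := Matrix.mem_unitaryGroup_iff'.1 U.2
  have h2 : (U : Matrix (Fin d) (Fin d) ℂ) * (U : Matrix (Fin d) (Fin d) ℂ)ᴴ = 1 :=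
    Matrix.mem_unitaryGroup_iff.1 U.2
  have h3 : ∀ i, (U : Matrix (Fin d) (Fin d) ℂ) * c (σ i) * (U : Matrix (Fin d) (Fin d) ℂ)ᴴ
      = s i • c i := by
    intro i
    rw [h, smul_mul_assoc, mul_assoc, h2, mul_one]
  have h4 : ∀ i, (U : Matrix (Fin d) (Fin d) ℂ)ᴴ * c i * U = s i • c (σ i) := by
    intro i
    have : c i = s i • ((U : Matrix (Fin d) (Fin d) ℂ) * c (σ i) *
        (U : Matrix (Fin d) (Fin d) ℂ)ᴴ) := by
      rw [h3, smul_smul, hs', one_smul]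
    rw [this, mul_smul_comm, smul_mul_assoc]
    congr 1
    simp only [mul_assoc]
    rw [h1, mul_one, ← mul_assoc, h1, one_mul]
  simp only [spanSuperoperator_apply, matInner_conj, h4, Finset.mul_sum, Finset.sum_mul,
    mul_smul_comm, smul_mul_assoc]
  -- After this reindexing both sides carry a factor `s i`: one from `Uᴴ * c i * U` inside the inner
  -- product, the other from `U * c (σ i) * Uᴴ`.
  rw [← Equiv.sum_comp σ (fun i => matInner (c i) X • ((U : Matrix (Fin d) (Fin d) ℂ) * c i *
    (U : Matrix (Fin d) (Fin d) ℂ)ᴴ))]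
  refine Finset.sum_congr rfl fun i _ => ?_
  rw [h3, smul_smul]
  congr 1
  simp only [matInner, Matrix.conjTranspose_smul, hs, smul_mul_assoc, Matrix.trace_smul,
    smul_eq_mul]
  ring

/-! ### Restriction to the `n`-particle sector and irreducibility. -/

namespace Fock

variable {ι : Type*} [Fintype ι] [LinearOrder ι]

/-- The projection onto the `k`-particle sector. -/
def sector (k : ℕ) : Matrix (Finset ι) (Finset ι) ℂ :=
  Matrix.diagonal fun S => if S.card = k then 1 else 0

lemma sector_mulVec (k : ℕ) (f : Finset ι → ℂ) (S : Finset ι) :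
    (sector k *ᵥ f) S = if S.card = k then f S else 0 := by
  simp [sector, Matrix.mulVec_diagonal]

/-- With `2n+1` modes the Hodge star sends `n` particles to `n+1`, and the annihilator returns to
`n`. -/
lemma commute_sector_annHodge {n : ℕ} (hn : Fintype.card ι = 2 * n + 1) (i : ι) :
    Commute (sector n) (annHodge i) := by
  refine matrix_ext fun f S => ?_
  simp only [annHodge, ← Matrix.mulVec_mulVec, ann_mulVec, sector_mulVec, hodge_mulVec]
  by_cases hi : i ∈ S
  · simp [hi]
  · have h := Finset.card_compl_add_card (insert i S)
    rw [Finset.card_insert_of_notMem hi] at h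
    have : (insert i S)ᶜ.card = n ↔ S.card = n := by omega
    simp only [hi, if_false, this]
    split_ifs <;> simp

lemma commute_sector_conjTranspose_mul (n : ℕ) (i j : ι) :
    Commute (sector n) ((ann i)ᴴ * ann j) := by
  refine matrix_ext fun f S => ?_
  simp only [← Matrix.mulVec_mulVec, ann_mulVec, ann_conjTranspose_mulVec, sector_mulVec]
  by_cases hi : i ∈ S
  · by_cases hj : j ∈ S.erase i
    · simp [hi, hj]
    · have : (insert j (S.erase i)).card = S.card := by
        rw [Finset.card_insert_of_notMem hj, Finset.card_erase_add_one hi]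
      simp [hi, hj, this]
  · simp [hi]

lemma commute_sector_parity (n : ℕ) (i : ι) : Commute (sector n) (parity i) :=
  (Commute.one_right _).sub_right ((commute_sector_conjTranspose_mul n i i).smul_right _)

lemma commute_sector_swap (n : ℕ) (i j : ι) : Commute (sector n) (swap i j) := by
  refine (Commute.one_right _).sub_right ?_
  rw [Matrix.conjTranspose_sub, sub_mul, mul_sub, mul_sub]
  exact ((commute_sector_conjTranspose_mul n i i).sub_right
    (commute_sector_conjTranspose_mul n i j)).sub_right
    ((commute_sector_conjTranspose_mul n j i).sub_right
    (commute_sector_conjTranspose_mul n j j))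

omit [Fintype ι] in
lemma conjTranspose_sector (n : ℕ) :
    (sector n : Matrix (Finset ι) (Finset ι) ℂ)ᴴ = sector n := by
  rw [sector, Matrix.diagonal_conjTranspose]
  congr 1
  ext S
  simp [apply_ite]

lemma commute_sector_conjTranspose {n : ℕ} {A : Matrix (Finset ι) (Finset ι) ℂ}
    (h : Commute (sector n) A) : Commute (sector n) Aᴴ := by
  have := congrArg Matrix.conjTranspose h.eq
  rw [Matrix.conjTranspose_mul, Matrix.conjTranspose_mul, conjTranspose_sector] at this
  exact this.symm

lemma commute_sector_annHodgeSum {n : ℕ} (hn : Fintype.card ι = 2 * n + 1) (v : ι → ℂ) :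
    Commute (sector n) (annHodgeSum v) :=
  Commute.sum_right _ _ _ fun i _ => (commute_sector_annHodge hn i).smul_right _

section Restrict

variable {n d : ℕ} {e : Fin d → Finset ι}

omit [LinearOrder ι] in
lemma submatrix_mulVec (he : Function.Injective e)
    {A : Matrix (Finset ι) (Finset ι) ℂ} (w : Fin d → ℂ) (x : Fin d) :
    (A.submatrix e e *ᵥ w) x = (A *ᵥ Function.extend e w 0) (e x) := by
  simp only [Matrix.mulVec, dotProduct, Matrix.submatrix_apply]
  rw [← Finset.sum_subset (Finset.subset_univ (Finset.univ.map ⟨e, he⟩))]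
  · simp [he.extend_apply]
  · intro S _ hS
    rw [Function.extend_apply', Pi.zero_apply, mul_zero]
    simpa using hS

/-- A left factor commuting with the sector projection is block diagonal, so the intermediate sum
loses nothing. -/
lemma submatrix_mul_submatrix (he : Function.Injective e)
    (hr : ∀ S, S.card = n ↔ S ∈ Set.range e) {A : Matrix (Finset ι) (Finset ι) ℂ}
    (hA : Commute (sector n) A) (B : Matrix (Finset ι) (Finset ι) ℂ) :
    (A * B).submatrix e e = A.submatrix e e * B.submatrix e e := by
  ext x y
  simp only [Matrix.submatrix_apply, Matrix.mul_apply]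
  rw [← Finset.sum_subset (Finset.subset_univ (Finset.univ.map ⟨e, he⟩))]
  · simp
  · intro S _ hS
    have hS' : S.card ≠ n := by
      rw [Ne, hr]; simpa using hS
    have h := congrFun (congrFun hA.eq (e x)) S
    rw [sector, Matrix.diagonal_mul, Matrix.mul_diagonal, if_pos ((hr _).2 ⟨x, rfl⟩), one_mul,
      if_neg hS', mul_zero] at h
    rw [h, zero_mul]

/-- Restricting a symmetry of the Fock space to a sector. -/
lemma exists_symmetry (he : Function.Injective e)
    (hr : ∀ S, S.card = n ↔ S ∈ Set.range e) (hn : Fintype.card ι = 2 * n + 1)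
    {A : Matrix (Finset ι) (Finset ι) ℂ} (hA : Commute (sector n) A) (hA' : Aᴴ = A)
    (hA'' : A * A = 1) (σ : Equiv.Perm ι) (s : ι → ℂ) (hs : ∀ i, star (s i) = s i)
    (hs' : ∀ i, s i * s i = 1) (h : ∀ i, A * annHodge (σ i) = s i • (annHodge i * A)) :
    ∃ U ∈ superoperatorSymmetry (spanSuperoperator fun i : ι => (annHodge i).submatrix e e),
      (U : Matrix (Fin d) (Fin d) ℂ) = A.submatrix e e := by
  have hU : A.submatrix e e ∈ Matrix.unitaryGroup (Fin d) ℂ := by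
    rw [Matrix.mem_unitaryGroup_iff, Matrix.star_eq_conjTranspose, Matrix.conjTranspose_submatrix,
      hA', ← submatrix_mul_submatrix he hr hA, hA'', Matrix.submatrix_one _ he]
  refine ⟨⟨_, hU⟩, mem_superoperatorSymmetry σ s hs (fun i => ?_) hs', rfl⟩
  change A.submatrix e e * _ = s i • (_ * A.submatrix e e)
  rw [← submatrix_mul_submatrix he hr hA, h, ← submatrix_mul_submatrix he hr
    (commute_sector_annHodge hn i)]
  rfl

/-- Parities are diagonal and separate the basis sets, so an invariant subspace contains every basis
vector on which one of its elements is nonzero. Swaps spread the support to all `n`-sets. -/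
lemma irreduciblyCovariant (he : Function.Injective e)
    (hr : ∀ S, S.card = n ↔ S ∈ Set.range e) (hn : Fintype.card ι = 2 * n + 1) :
    IrreduciblyCovariant (spanSuperoperator fun i : ι => (annHodge i).submatrix e e) := by
  refine irreduciblyCovariant_of_symmetry _ fun W hW => ?_
  rw [or_iff_not_imp_left]
  intro hW0
  have hpar : ∀ i, ∀ w ∈ W, (fun x => (if i ∈ e x then -1 else 1) * w x) ∈ W := by
    intro i w hw
    obtain ⟨U, hU, hU'⟩ := exists_symmetry he hr hn (commute_sector_parity n i)
      (parity_isHermitian i) (parity_mul_self i) 1 (fun j => if i = j then 1 else -1)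
      (fun j => by split_ifs <;> simp) (fun j => by split_ifs <;> simp)
      (fun j => parity_mul_annHodge i j)
    have := hW U hU w hw
    rw [hU'] at this
    convert this using 1
    ext x
    rw [submatrix_mulVec he, parity_mulVec, he.extend_apply]
  have hswap : ∀ i j : ι, ∀ x y, i ∈ e x → j ∉ e x → e y = insert j ((e x).erase i) →
      (∃ w ∈ W, w y ≠ 0) → ∃ w ∈ W, w x ≠ 0 := by
    rintro i j x y hi hj hy ⟨w, hw, hwy⟩
    have hij : i ≠ j := by rintro rfl; exact hj hi
    obtain ⟨U, hU, hU'⟩ := exists_symmetry he hr hn (commute_sector_swap n i j)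
      (swap_isHermitian i j) (swap_mul_self hij) (Equiv.swap i j) (fun _ => -1)
      (fun j => by simp) (fun j => by simp)
      (fun k => by rw [swap_mul_annHodge hij, Equiv.swap_apply_self, neg_one_smul])
    refine ⟨_, hW U hU w hw, ?_⟩
    rw [hU', submatrix_mulVec he, swap_mulVec _ hi hj, ← hy, he.extend_apply]
    have hne : ∀ (k : ι) S, sgn k S ≠ 0 := fun k S h => by
      have := sgn_mul_self k S
      rw [h] at this; simp at this
    exact mul_ne_zero (mul_ne_zero (hne _ _) (hne _ _)) hwy
  have hproj : ∀ x, ∀ w ∈ W, ∀ A : Finset ι,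
      (fun y => if ∀ i ∈ A, (i ∈ e x ↔ i ∈ e y) then w y else 0) ∈ W := by
    intro x w hw A
    induction A using Finset.induction_on with
    | empty => simpa using hw
    | insert i A hi ih =>
      -- Half of identity plus or minus `parity i` projects onto the sets agreeing with `e x` at
      -- `i`.
      have h := W.smul_mem (2 : ℂ)⁻¹
        (W.add_mem ih (W.smul_mem (if i ∈ e x then -1 else 1) (hpar i _ ih)))
      convert h using 1
      ext y
      simp only [Finset.forall_mem_insert, Pi.smul_apply, Pi.add_apply, smul_eq_mul, ite_and]
      generalize (if ∀ i ∈ A, (i ∈ e x ↔ i ∈ e y) then w y else 0) = z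
      by_cases h1 : i ∈ e x <;> by_cases h2 : i ∈ e y <;> simp [h1, h2] <;> ring
  have hsingle : ∀ x, (∃ w ∈ W, w x ≠ 0) → Pi.single x (1 : ℂ) ∈ W := by
    rintro x ⟨w, hw, hwx⟩
    convert W.smul_mem (w x)⁻¹ (hproj x w hw Finset.univ) using 1
    ext y
    rcases eq_or_ne y x with rfl | hyx
    · simp [hwx]
    · have : ¬ ∀ i, (i ∈ e x ↔ i ∈ e y) := fun h => hyx (he (Finset.ext h)).symm
      simp [hyx, this]
  -- Induction on the number of modes in which the sets differ: `z` exchanges one `i ∈ e x \ e y`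
  -- for one `j ∈ e y \ e x`.
  have hall : ∀ k x y, (e y \ e x).card = k → (∃ w ∈ W, w y ≠ 0) → ∃ w ∈ W, w x ≠ 0 := by
    intro k
    induction k with
    | zero =>
      intro x y hk
      have hsub : e y ⊆ e x := by simpa [Finset.card_eq_zero] using hk
      have : e y = e x := Finset.eq_of_subset_of_card_le hsub
        (by rw [(hr (e x)).2 ⟨x, rfl⟩, (hr (e y)).2 ⟨y, rfl⟩])
      rw [he this]
      exact id
    | succ k ih =>
      intro x y hk hy
      have hcx := (hr (e x)).2 ⟨x, rfl⟩
      have hcy := (hr (e y)).2 ⟨y, rfl⟩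
      have hk' : (e x \ e y).card = k + 1 := by
        rw [← hk, Finset.card_sdiff_comm (hcx.trans hcy.symm)]
      obtain ⟨j, hj⟩ := Finset.card_pos.1 (by omega : 0 < (e y \ e x).card)
      obtain ⟨i, hi⟩ := Finset.card_pos.1 (by omega : 0 < (e x \ e y).card)
      rw [Finset.mem_sdiff] at hi hj
      obtain ⟨z, hz⟩ := (hr (insert j ((e x).erase i))).1 (by
        rw [Finset.card_insert_of_notMem (by simp [hj.2]), Finset.card_erase_add_one hi.1, hcx])
      refine hswap i j x z hi.1 hj.2 hz (ih z y ?_ hy)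
      have : e y \ e z = (e y \ e x).erase j := by
        rw [hz]
        ext l
        simp only [Finset.mem_sdiff, Finset.mem_insert, Finset.mem_erase]
        rcases eq_or_ne l i with rfl | hli
        · simp [hi.1, hi.2]
        · tauto
      rw [this, Finset.card_erase_of_mem (Finset.mem_sdiff.2 hj), hk]
      rfl
  obtain ⟨w, hw, hw0⟩ := W.ne_bot_iff.1 hW0
  obtain ⟨y, hy⟩ := Function.ne_iff.1 hw0
  rw [eq_top_iff]
  intro u _
  rw [pi_eq_sum_univ' u]
  refine W.sum_mem fun x _ => W.smul_mem _ ?_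
  exact hsingle x (hall _ x y rfl ⟨w, hw, hy⟩)

end Restrict

end Fock

/-! ### Frobenius norm, Schatten 2-norm and operator norm. -/

/-- The squared Frobenius norm `∑ i j, |A i j|²`. -/
noncomputable def frobeniusSq {d : ℕ} (A : Matrix (Fin d) (Fin d) ℂ) : ℝ := ∑ i, ∑ j, ‖A i j‖ ^ 2

lemma frobeniusSq_nonneg {d : ℕ} (A : Matrix (Fin d) (Fin d) ℂ) : 0 ≤ frobeniusSq A := by
  unfold frobeniusSq; positivity

lemma trace_conjTranspose_mul_self {d : ℕ} (A : Matrix (Fin d) (Fin d) ℂ) :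
    (Aᴴ * A).trace = (frobeniusSq A : ℂ) := by
  simp only [Matrix.trace, Matrix.diag_apply, Matrix.mul_apply, Matrix.conjTranspose_apply,
    frobeniusSq, Complex.ofReal_sum]
  rw [Finset.sum_comm]
  refine Finset.sum_congr rfl fun i _ => Finset.sum_congr rfl fun j _ => ?_
  rw [Complex.star_def, ← Complex.normSq_eq_conj_mul_self, Complex.normSq_eq_norm_sq]

lemma norm_trace_conjTranspose_mul_le {d : ℕ} (A B : Matrix (Fin d) (Fin d) ℂ) :
    ‖(Aᴴ * B).trace‖ ≤ √(frobeniusSq A) * √(frobeniusSq B) := by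
  have h : (Aᴴ * B).trace = ∑ p : Fin d × Fin d, star (A p.1 p.2) * B p.1 p.2 := by
    simp only [Matrix.trace, Matrix.diag_apply, Matrix.mul_apply, Matrix.conjTranspose_apply]
    rw [Finset.sum_comm, Fintype.sum_prod_type]
  rw [h, frobeniusSq, frobeniusSq, ← Fintype.sum_prod_type', ← Fintype.sum_prod_type']
  refine (norm_sum_le _ _).trans (le_trans (le_of_eq ?_) (Real.sum_mul_le_sqrt_mul_sqrt _ _ _))
  simp

lemma schattenNorm_two {d : ℕ} (X : Matrix (Fin d) (Fin d) ℂ) :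
    schattenNorm 2 X = √((d : ℝ)⁻¹ * frobeniusSq X) := by
  have h : (fun t : ℝ => t ^ ((2 : ℝ≥0∞).toReal / 2)) = fun t => t := by
    ext t; simp
  have hs : IsSelfAdjoint (Xᴴ * X) := IsSelfAdjoint.star_mul_self X
  rw [schattenNorm, if_neg (by simp), h, cfc_id' ℝ (Xᴴ * X) hs, trace_conjTranspose_mul_self,
    Complex.ofReal_re, Real.sqrt_eq_rpow]
  simp

lemma ellTwoNorm_smul {d : ℕ} (r : ℝ) (x : Fin d → ℂ) :
    ellTwoNorm ((r : ℂ) • x) = √((d : ℝ)⁻¹ * (r ^ 2 * ∑ i, ‖x i‖ ^ 2)) := by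
  simp [ellTwoNorm, mul_pow, Finset.mul_sum]

lemma norm_le_of_ellTwoNorm_le_one {d : ℕ} (hd : 0 < d) {x : Fin d → ℂ} (hx : ellTwoNorm x ≤ 1)
    (i : Fin d) : ‖x i‖ ≤ d := by
  have hd' : (1 : ℝ) ≤ d := by exact_mod_cast hd
  have h : ∑ i, ‖x i‖ ^ 2 ≤ d := by
    rw [ellTwoNorm, Real.sqrt_le_one, inv_mul_le_iff₀ (by linarith), mul_one] at hx
    exact hx
  have h' : ‖x i‖ ^ 2 ≤ ∑ i, ‖x i‖ ^ 2 :=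
    Finset.single_le_sum (f := fun i => ‖x i‖ ^ 2) (fun _ _ => by positivity) (Finset.mem_univ i)
  nlinarith [norm_nonneg (x i)]

/-- A crude bound suffices; without boundedness the real `sSup` would default to `0` and control
nothing. -/
lemma bddAbove_operatorNorm {d : ℕ} (hd : 0 < d) (X : Matrix (Fin d) (Fin d) ℂ) :
    BddAbove {r : ℝ | ∃ x y : Fin d → ℂ,
      ellTwoNorm x ≤ 1 ∧ ellTwoNorm y ≤ 1 ∧ r = ‖vecInner (X *ᵥ x) y‖} := by
  refine ⟨(d : ℝ)⁻¹ * ∑ i, (∑ j, ‖X i j‖ * d) * d, ?_⟩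
  rintro r ⟨x, y, hx, hy, rfl⟩
  rw [vecInner, norm_mul, norm_inv, Complex.norm_natCast]
  gcongr
  refine norm_sum_le_of_le _ fun i _ => ?_
  rw [norm_mul, norm_star]
  gcongr
  · change ‖∑ j, X i j * x j‖ ≤ _
    refine norm_sum_le_of_le _ fun j _ => ?_
    rw [norm_mul]
    gcongr
    exact norm_le_of_ellTwoNorm_le_one hd hx j
  · exact norm_le_of_ellTwoNorm_le_one hd hy i

lemma sum_norm_mulVec_le {d : ℕ} (hd : 0 < d) {X : Matrix (Fin d) (Fin d) ℂ}
    (hX : schattenNorm ∞ X ≤ 1) (x : Fin d → ℂ) :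
    ∑ i, ‖(X *ᵥ x) i‖ ^ 2 ≤ ∑ i, ‖x i‖ ^ 2 := by
  have hd' : (0 : ℝ) < d := by exact_mod_cast hd
  set s := ∑ i, ‖x i‖ ^ 2 with hs
  set t := ∑ i, ‖(X *ᵥ x) i‖ ^ 2 with ht
  have hs0 : 0 ≤ s := by positivity
  have ht0 : 0 ≤ t := by positivity
  rcases hs0.eq_or_lt with h0 | hs0
  · have hx : x = 0 := by
      ext i
      have := (Finset.sum_eq_zero_iff_of_nonneg (fun i _ => by positivity)).1 h0.symm i
        (Finset.mem_univ i)
      simpa using this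
    rw [← h0, ht, hx]
    simp
  rcases ht0.eq_or_lt with h0 | ht0
  · rw [← h0]; exact hs0.le
  -- The operator norm is tested on `x` and `X *ᵥ x`; the `d` in the scaling offsets the `1/d` in
  -- `ellTwoNorm`.
  have key : ∀ {z : Fin d → ℂ} {u : ℝ}, 0 < u → ∑ i, ‖z i‖ ^ 2 = u →
      ellTwoNorm (((√(d / u) : ℝ) : ℂ) • z) ≤ 1 := by
    intro z u hu hz
    rw [ellTwoNorm_smul, hz, Real.sq_sqrt (by positivity)]
    rw [div_mul_cancel₀ _ hu.ne', inv_mul_cancel₀ hd'.ne', Real.sqrt_one]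
  have h := (le_csSup (bddAbove_operatorNorm hd X) ⟨_, _, key hs0 rfl, key ht0 rfl, rfl⟩).trans
    (by simpa [schattenNorm] using hX)
  have e : vecInner (X *ᵥ (((√(d / s) : ℝ) : ℂ) • x)) (((√(d / t) : ℝ) : ℂ) • (X *ᵥ x))
      = (((d : ℝ)⁻¹ * (√(d / s) * √(d / t) * t) : ℝ) : ℂ) := by
    rw [Matrix.mulVec_smul, vecInner]
    push_cast
    have ht' : (t : ℂ) = ∑ i, (‖(X *ᵥ x) i‖ : ℂ) ^ 2 := by rw [ht]; push_cast; rfl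
    congr 1
    conv_rhs => rw [ht', Finset.mul_sum]
    refine Finset.sum_congr rfl fun i _ => ?_
    rw [← Complex.conj_mul' ((X *ᵥ x) i)]
    simp only [Pi.smul_apply, smul_eq_mul, star_mul', Complex.star_def, Complex.conj_ofReal]
    ring
  rw [e, Complex.norm_real, Real.norm_of_nonneg (by positivity), ← Real.sqrt_mul (by positivity),
    inv_mul_le_iff₀ hd', mul_one] at h
  have h2 : (√(d / s * (d / t)) * t) ^ 2 ≤ (d : ℝ) ^ 2 := by gcongr
  rw [mul_pow, Real.sq_sqrt (by positivity)] at h2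
  have h3 : d / s * (d / t) * t ^ 2 = (d : ℝ) ^ 2 * (t / s) := by field_simp
  rw [h3] at h2
  have h4 : t / s ≤ 1 := by
    by_contra! h5
    nlinarith [pow_pos hd' 2]
  exact (div_le_one hs0).1 h4

lemma frobeniusSq_mul_le {d : ℕ} (hd : 0 < d) {X : Matrix (Fin d) (Fin d) ℂ}
    (hX : schattenNorm ∞ X ≤ 1) (A : Matrix (Fin d) (Fin d) ℂ) :
    frobeniusSq (X * A) ≤ frobeniusSq A := by
  rw [frobeniusSq, frobeniusSq, Finset.sum_comm, Finset.sum_comm (f := fun i j => ‖A i j‖ ^ 2)]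
  refine Finset.sum_le_sum fun j _ => ?_
  exact sum_norm_mulVec_le hd hX fun i => A i j

lemma conjExponent_one : ENNReal.conjExponent 1 = ∞ := by simp [ENNReal.conjExponent]

lemma conjExponent_two : ENNReal.conjExponent 2 = 2 := by
  have : (2 : ℝ≥0∞) - 1 = 1 := by
    rw [← one_add_one_eq_two]; exact ENNReal.add_sub_cancel_right ENNReal.one_ne_top
  rw [ENNReal.conjExponent, this, inv_one, one_add_one_eq_two]

lemma superNorm_nonneg {d : ℕ} (p q : ℝ≥0∞) (Φ : Superoperator d) : 0 ≤ superNorm p q Φ := by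
  refine Real.sSup_nonneg ?_
  rintro r ⟨X, Y, -, -, rfl⟩
  exact norm_nonneg _

lemma star_matInner {d : ℕ} (X Y : Matrix (Fin d) (Fin d) ℂ) :
    star (matInner X Y) = matInner Y X := by
  rw [matInner, matInner, star_mul', ← Matrix.trace_conjTranspose, Matrix.conjTranspose_mul,
    Matrix.conjTranspose_conjTranspose]
  simp

/-! ### Norm bounds for `spanSuperoperator`. -/

section Span

variable {ι : Type*} [Fintype ι] {d : ℕ} {c : ι → Matrix (Fin d) (Fin d) ℂ} {κ : ℝ}

lemma matInner_spanSuperoperator (X Y : Matrix (Fin d) (Fin d) ℂ) :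
    matInner Y (spanSuperoperator c X) = ∑ i, matInner (c i) X * matInner Y (c i) := by
  rw [spanSuperoperator_apply]
  simp only [matInner, Finset.mul_sum, Matrix.trace_sum, Matrix.trace_smul,
    mul_smul_comm, smul_eq_mul]
  exact Finset.sum_congr rfl fun i _ => by ring

lemma norm_matInner_spanSuperoperator_le (X Y : Matrix (Fin d) (Fin d) ℂ) :
    ‖matInner Y (spanSuperoperator c X)‖ ≤
      √(∑ i, ‖matInner (c i) X‖ ^ 2) * √(∑ i, ‖matInner (c i) Y‖ ^ 2) := by
  rw [matInner_spanSuperoperator]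
  refine (norm_sum_le _ _).trans (le_trans (le_of_eq ?_) (Real.sum_mul_le_sqrt_mul_sqrt _ _ _))
  refine Finset.sum_congr rfl fun i _ => ?_
  rw [norm_mul, ← star_matInner Y (c i), norm_star]

lemma matInner_sum_smul (v : ι → ℂ) (X : Matrix (Fin d) (Fin d) ℂ) :
    matInner (∑ i, v i • c i) X = ∑ i, star (v i) * matInner (c i) X := by
  simp only [matInner, Matrix.conjTranspose_sum, Matrix.conjTranspose_smul, Finset.sum_mul,
    Matrix.trace_sum, Matrix.trace_smul, smul_mul_assoc, smul_eq_mul, Finset.mul_sum]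
  exact Finset.sum_congr rfl fun i _ => by ring

lemma trace_eq_mul_matInner (hd : 0 < d) (X Y : Matrix (Fin d) (Fin d) ℂ) :
    (Yᴴ * X).trace = d * matInner Y X := by
  have : (d : ℂ) ≠ 0 := by exact_mod_cast hd.ne'
  rw [matInner, mul_inv_cancel_left₀ this]

/-- If the combinations of the orthogonal family `c` are multiples of partial isometries, then the
projection of the unit ball of the operator norm to their span is bounded. -/
lemma sum_norm_matInner_le [DecidableEq ι] (hd : 0 < d) (hκ : 0 ≤ κ)
    (horth : ∀ i j, matInner (c i) (c j) = if i = j then (κ : ℂ) else 0)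
    (hiso : ∀ v : ι → ℂ, (∑ i, v i • c i) * (∑ i, v i • c i)ᴴ * (∑ i, v i • c i)
      = (∑ i, v i * star (v i)) • ∑ i, v i • c i)
    {X : Matrix (Fin d) (Fin d) ℂ} (hX : schattenNorm ∞ X ≤ 1) :
    √(∑ i, ‖matInner (c i) X‖ ^ 2) ≤ κ := by
  have hd' : (0 : ℝ) < d := by exact_mod_cast hd
  -- With these coefficients `⟨C, X⟩ = t = |v|²`, so `C` is the extremal test matrix.
  set v : ι → ℂ := fun i => matInner (c i) X with hv
  set t : ℝ := ∑ i, ‖v i‖ ^ 2 with ht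
  have ht0 : 0 ≤ t := by positivity
  set C := ∑ i, v i • c i with hC
  have hvt : ∑ i, v i * star (v i) = (t : ℂ) := by
    rw [ht, Complex.ofReal_sum]
    refine Finset.sum_congr rfl fun i _ => ?_
    rw [Complex.star_def, Complex.mul_conj']
    push_cast; rfl
  have h3 : C * Cᴴ * C = (t : ℂ) • C := by rw [hiso v, hvt]
  have hCX : (Cᴴ * X).trace = ((d * t : ℝ) : ℂ) := by
    rw [trace_eq_mul_matInner hd, hC, matInner_sum_smul, Complex.ofReal_mul, ← hvt]
    simp [hv, mul_comm]
  have hCC : frobeniusSq C = d * (κ * t) := by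
    have : (frobeniusSq C : ℂ) = ((d * (κ * t) : ℝ) : ℂ) := by
      rw [← trace_conjTranspose_mul_self, trace_eq_mul_matInner hd]
      have h1 : ∀ i, matInner (c i) C = v i * κ := by
        intro i
        have := matInner_sum_smul (c := c) v (c i)
        rw [← star_matInner]
        rw [← hC] at this
        rw [this]
        simp [horth]
      rw [hC, matInner_sum_smul, ← hC]
      push_cast
      rw [← hvt, Finset.mul_sum (a := (κ : ℂ))]
      congr 1
      exact Finset.sum_congr rfl fun i _ => by rw [h1]; ring
    exact_mod_cast this
  have h4 : frobeniusSq (Cᴴ * C) = t * frobeniusSq C := by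
    have : (frobeniusSq (Cᴴ * C) : ℂ) = ((t * frobeniusSq C : ℝ) : ℂ) := by
      rw [← trace_conjTranspose_mul_self, Complex.ofReal_mul, ← trace_conjTranspose_mul_self,
        Matrix.conjTranspose_mul, Matrix.conjTranspose_conjTranspose, mul_assoc, ← mul_assoc C,
        h3, mul_smul_comm, Matrix.trace_smul, smul_eq_mul]
    exact_mod_cast this
  -- This replaces trace-norm duality: `Cᴴ C Cᴴ = t Cᴴ` inserts `Cᴴ C` next to `X`, and
  -- Cauchy–Schwarz in the Frobenius norm then gives `√t ‖C‖²` as the bound.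
  have h5 : t * ((d : ℝ) * t) = ‖(Cᴴ * (X * (Cᴴ * C))).trace‖ := by
    have h6 : Cᴴ * C * Cᴴ = (t : ℂ) • Cᴴ := by
      have := congrArg Matrix.conjTranspose h3
      simpa [Matrix.conjTranspose_mul, mul_assoc] using this
    have : (Cᴴ * (X * (Cᴴ * C))).trace = ((t * (d * t) : ℝ) : ℂ) := by
      rw [← mul_assoc, Matrix.trace_mul_comm, ← mul_assoc, h6, smul_mul_assoc, Matrix.trace_smul,
        hCX, smul_eq_mul, Complex.ofReal_mul t]
    rw [this, Complex.norm_real, Real.norm_of_nonneg (by positivity)]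
  have h7 : t * ((d : ℝ) * t) ≤ √t * (d * (κ * t)) := by
    rw [h5, ← hCC]
    refine (norm_trace_conjTranspose_mul_le _ _).trans ?_
    calc √(frobeniusSq C) * √(frobeniusSq (X * (Cᴴ * C)))
        ≤ √(frobeniusSq C) * √(frobeniusSq (Cᴴ * C)) := by
          gcongr
          exact frobeniusSq_mul_le hd hX _
      _ = √t * frobeniusSq C := by
          rw [h4, Real.sqrt_mul ht0, mul_left_comm, Real.mul_self_sqrt (frobeniusSq_nonneg C)]
  rcases ht0.eq_or_lt with h0 | ht0
  · rw [← h0, Real.sqrt_zero]; exact hκ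
  have h8 : √t * √t = t := Real.mul_self_sqrt ht0.le
  have h9 : 0 < √t := Real.sqrt_pos.2 ht0
  refine le_of_mul_le_mul_left ?_ (by positivity : 0 < d * t * √t)
  calc d * t * √t * √t = t * (d * t) := by rw [mul_assoc, h8]; ring
    _ ≤ √t * (d * (κ * t)) := h7
    _ = d * t * √t * κ := by ring

/-- The exponent conjugate to `1` is `∞`, so `X` and `Y` both lie in the operator unit ball and each
contributes a factor `κ`. -/
lemma superNorm_top_one_le [DecidableEq ι] (hd : 0 < d) (hκ : 0 ≤ κ)
    (horth : ∀ i j, matInner (c i) (c j) = if i = j then (κ : ℂ) else 0)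
    (hiso : ∀ v : ι → ℂ, (∑ i, v i • c i) * (∑ i, v i • c i)ᴴ * (∑ i, v i • c i)
      = (∑ i, v i * star (v i)) • ∑ i, v i • c i) :
    superNorm ∞ 1 (spanSuperoperator c) ≤ κ ^ 2 := by
  refine Real.sSup_le ?_ (by positivity)
  rintro r ⟨X, Y, hX, hY, rfl⟩
  rw [conjExponent_one] at hY
  rw [pow_two]
  refine (norm_matInner_spanSuperoperator_le X Y).trans ?_
  gcongr
  · exact sum_norm_matInner_le hd hκ horth hiso hX
  · exact sum_norm_matInner_le hd hκ horth hiso hY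

lemma frobeniusSq_le_of_schattenNorm_two_le (hd : 0 < d) {X : Matrix (Fin d) (Fin d) ℂ}
    (hX : schattenNorm 2 X ≤ 1) : frobeniusSq X ≤ d := by
  have hd' : (0 : ℝ) < d := by exact_mod_cast hd
  rwa [schattenNorm_two, Real.sqrt_le_one, inv_mul_le_iff₀ hd', mul_one] at hX

lemma norm_matInner_le (hd : 0 < d) (A : Matrix (Fin d) (Fin d) ℂ)
    {X : Matrix (Fin d) (Fin d) ℂ} (hX : schattenNorm 2 X ≤ 1) :
    ‖matInner A X‖ ≤ (d : ℝ)⁻¹ * (√(frobeniusSq A) * √d) := by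
  rw [matInner, norm_mul, norm_inv, Complex.norm_natCast]
  gcongr
  refine (norm_trace_conjTranspose_mul_le A X).trans ?_
  gcongr
  exact frobeniusSq_le_of_schattenNorm_two_le hd hX

/-- The normalized eigenvector `c i / √κ`, used for both `X` and `Y`, attains the value `κ`. -/
lemma le_superNorm_two_two [DecidableEq ι] [Nonempty ι] (hd : 0 < d) (hκ : 0 < κ)
    (horth : ∀ i j, matInner (c i) (c j) = if i = j then (κ : ℂ) else 0) :
    κ ≤ superNorm 2 2 (spanSuperoperator c) := by
  have hd' : (0 : ℝ) < d := by exact_mod_cast hd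
  obtain ⟨i⟩ := ‹Nonempty ι›
  have hbdd : BddAbove {r : ℝ | ∃ X Y : Matrix (Fin d) (Fin d) ℂ,
      schattenNorm 2 X ≤ 1 ∧ schattenNorm (ENNReal.conjExponent 2) Y ≤ 1 ∧
        r = ‖matInner Y (spanSuperoperator c X)‖} := by
    refine ⟨√(∑ i, ((d : ℝ)⁻¹ * (√(frobeniusSq (c i)) * √d)) ^ 2) *
      √(∑ i, ((d : ℝ)⁻¹ * (√(frobeniusSq (c i)) * √d)) ^ 2), ?_⟩
    rintro r ⟨X, Y, hX, hY, rfl⟩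
    rw [conjExponent_two] at hY
    refine (norm_matInner_spanSuperoperator_le X Y).trans ?_
    gcongr
    · exact norm_matInner_le hd _ hX
    · exact norm_matInner_le hd _ hY
  have hfrob : frobeniusSq (((√κ)⁻¹ : ℂ) • c i) = d := by
    have : (frobeniusSq (((√κ)⁻¹ : ℂ) • c i) : ℂ) = ((d : ℝ) : ℂ) := by
      have hk : ((√κ : ℝ) : ℂ) * ((√κ : ℝ) : ℂ) = κ := by
        rw [← Complex.ofReal_mul, Real.mul_self_sqrt hκ.le]
      have hk0 : ((√κ : ℝ) : ℂ) ≠ 0 := by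
        exact_mod_cast (Real.sqrt_pos.2 hκ).ne'
      rw [← trace_conjTranspose_mul_self, Matrix.conjTranspose_smul, smul_mul_smul_comm,
        Matrix.trace_smul, trace_eq_mul_matInner hd, horth, if_pos rfl, ← hk]
      simp
      field_simp
    exact_mod_cast this
  have hnorm : schattenNorm 2 (((√κ)⁻¹ : ℂ) • c i) ≤ 1 := by
    rw [schattenNorm_two, hfrob, inv_mul_cancel₀ hd'.ne', Real.sqrt_one]
  refine le_csSup hbdd ⟨_, _, hnorm, by rw [conjExponent_two]; exact hnorm, ?_⟩
  rw [map_smul, spanSuperoperator_apply]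
  simp only [horth]
  simp only [ite_smul, zero_smul, Finset.sum_ite_eq', Finset.mem_univ, if_true]
  have : matInner ((((√κ : ℝ) : ℂ))⁻¹ • c i) ((((√κ : ℝ) : ℂ))⁻¹ • (κ : ℂ) • c i) = κ := by
    have hk : ((√κ : ℝ) : ℂ) * ((√κ : ℝ) : ℂ) = κ := by
      rw [← Complex.ofReal_mul, Real.mul_self_sqrt hκ.le]
    have hk0 : ((√κ : ℝ) : ℂ) ≠ 0 := by
      exact_mod_cast (Real.sqrt_pos.2 hκ).ne'
    have h := horth i i
    rw [if_pos rfl, matInner] at h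
    rw [matInner, Matrix.conjTranspose_smul, smul_smul, smul_mul_smul_comm, Matrix.trace_smul,
      smul_eq_mul, mul_left_comm, h, ← hk]
    simp
    field_simp
  rw [this, Complex.norm_real, Real.norm_of_nonneg hκ.le]

end Span

/-! ### Orthogonality of the restricted operators. -/

namespace Fock

variable {ι : Type*} [Fintype ι] [LinearOrder ι]

lemma ann_mul_conjTranspose_diag (i j : ι) (S : Finset ι) :
    (ann j * (ann i)ᴴ) S S = if i = j then (if i ∈ S then 0 else 1) else 0 := by
  have h : (ann j * (ann i)ᴴ) S S = ((ann j * (ann i)ᴴ) *ᵥ Pi.single S 1) S := by simp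
  rw [h, ← Matrix.mulVec_mulVec, ann_mulVec]
  rcases eq_or_ne i j with rfl | hij
  · by_cases hi : i ∈ S
    · simp [hi]
    · simp [hi, ann_conjTranspose_mulVec, sgn_insert hi, sgn_mul_self]
  · by_cases hj : j ∈ S
    · simp [hij, hj]
    · have hS : (insert j S).erase i ≠ S := fun h => hj (by
        rw [← h]; simp [hij.symm])
      simp [hij, hj, ann_conjTranspose_mulVec, hS]

lemma annHodge_mul_conjTranspose (i j : ι) :
    annHodge j * (annHodge i)ᴴ = ann j * (ann i)ᴴ := by
  rw [annHodge, annHodge, Matrix.conjTranspose_mul, ← mul_assoc, mul_assoc (ann j),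
    hodge_mul_conjTranspose, mul_one]

variable {n d : ℕ} {e : Fin d → Finset ι}

/-- By cyclicity the Hodge star cancels, and for `i = j` the trace counts the `n`-sets avoiding `i`,
that is, `n`-subsets of `2n` modes. -/
lemma trace_annHodge (he : Function.Injective e) (hr : ∀ S, S.card = n ↔ S ∈ Set.range e)
    (hn : Fintype.card ι = 2 * n + 1) (i j : ι) :
    (((annHodge i).submatrix e e)ᴴ * (annHodge j).submatrix e e).trace
      = if i = j then (n.centralBinom : ℂ) else 0 := by
  rw [Matrix.trace_mul_comm, Matrix.conjTranspose_submatrix,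
    ← submatrix_mul_submatrix he hr (commute_sector_annHodge hn j), annHodge_mul_conjTranspose]
  simp only [Matrix.trace, Matrix.diag_apply, Matrix.submatrix_apply, ann_mul_conjTranspose_diag]
  rcases eq_or_ne i j with rfl | hij
  · simp only [if_true]
    have h1 : ∑ x, (if i ∈ e x then (0 : ℂ) else 1)
        = ∑ S ∈ Finset.univ.map ⟨e, he⟩, if i ∈ S then (0 : ℂ) else 1 := by simp
    have h2 : Finset.univ.map ⟨e, he⟩ = Finset.powersetCard n Finset.univ := by
      ext S
      rw [Finset.mem_powersetCard_univ, hr]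
      simp
    have h3 : (Finset.powersetCard n Finset.univ).filter (fun S : Finset ι => i ∉ S)
        = Finset.powersetCard n (Finset.univ.erase i) := by
      ext S
      simp only [Finset.mem_filter, Finset.mem_powersetCard, Finset.subset_erase,
        Finset.subset_univ, true_and]
      tauto
    have h4 : ∀ S : Finset ι, (if i ∈ S then (0 : ℂ) else 1) = if i ∉ S then 1 else 0 :=
      fun S => by split_ifs <;> simp_all
    rw [h1, h2]
    simp only [h4]
    rw [Finset.sum_boole, h3, Finset.card_powersetCard,
      Finset.card_erase_of_mem (Finset.mem_univ i), Finset.card_univ, hn, Nat.add_sub_cancel, Nat.centralBinom]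
  · simp [hij]

lemma sum_smul_submatrix_annHodge (v : ι → ℂ) :
    ∑ i, v i • (annHodge i).submatrix e e = (annHodgeSum v).submatrix e e := by
  ext x y
  simp [annHodgeSum, Matrix.sum_apply]

lemma sum_smul_mul_conjTranspose (he : Function.Injective e)
    (hr : ∀ S, S.card = n ↔ S ∈ Set.range e) (hn : Fintype.card ι = 2 * n + 1) (v : ι → ℂ) :
    (∑ i, v i • (annHodge i).submatrix e e) * (∑ i, v i • (annHodge i).submatrix e e)ᴴ *
      (∑ i, v i • (annHodge i).submatrix e e)
      = (∑ i, v i * star (v i)) • ∑ i, v i • (annHodge i).submatrix e e := by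
  have h := commute_sector_annHodgeSum hn v
  rw [sum_smul_submatrix_annHodge, Matrix.conjTranspose_submatrix,
    ← submatrix_mul_submatrix he hr h, ← submatrix_mul_submatrix he hr
      (h.mul_right (commute_sector_conjTranspose h)), annHodgeSum_mul_conjTranspose]
  rfl

end Fock

/-! ### The extremal family and the limit. -/

/-- The superoperators built from the annihilation operators on the middle sectors of the
antisymmetric Fock space of odd dimension. -/
lemma exists_irreduciblyCovariant (n : ℕ) :
    ∃ (d : ℕ) (Φ : Superoperator d), 0 < d ∧ IrreduciblyCovariant Φ ∧
      ((n + 1 : ℝ) / (2 * n + 1)) ≤ superNorm 2 2 Φ ∧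
      superNorm ∞ 1 Φ ≤ ((n + 1 : ℝ) / (2 * n + 1)) ^ 2 := by
  have hcard : (Finset.powersetCard n (Finset.univ : Finset (Fin (2 * n + 1)))).card
      = (2 * n + 1).choose n := by
    rw [Finset.card_powersetCard, Finset.card_univ, Fintype.card_fin]
  set d := (2 * n + 1).choose n with hd
  have hd0 : 0 < d := Nat.choose_pos (by omega)
  set φ := Finset.equivFinOfCardEq hcard
  set e : Fin d → Finset (Fin (2 * n + 1)) := fun x => (φ.symm x : Finset (Fin (2 * n + 1)))
  have he : Function.Injective e := Subtype.val_injective.comp φ.symm.injective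
  have hr : ∀ S, S.card = n ↔ S ∈ Set.range e := by
    intro S
    rw [← Finset.mem_powersetCard_univ]
    constructor
    · intro h
      exact ⟨φ ⟨S, h⟩, by simp [e]⟩
    · rintro ⟨x, rfl⟩
      exact (φ.symm x).2
  have hn : Fintype.card (Fin (2 * n + 1)) = 2 * n + 1 := Fintype.card_fin _
  have hκ : (0 : ℝ) < (n + 1 : ℝ) / (2 * n + 1) := by positivity
  have horth : ∀ i j : Fin (2 * n + 1),
      matInner ((Fock.annHodge i).submatrix e e) ((Fock.annHodge j).submatrix e e)
        = if i = j then (((n + 1 : ℝ) / (2 * n + 1) : ℝ) : ℂ) else 0 := by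
    intro i j
    rw [matInner, Fock.trace_annHodge he hr hn]
    split_ifs
    -- Here `κ = (2n).choose n / (2n+1).choose n` is evaluated, using `(2n+1).choose (n+1) =
    -- (2n+1).choose n`.
    · have h : (2 * n + 1) * n.centralBinom = d * (n + 1) := by
        rw [Nat.centralBinom, Nat.add_one_mul_choose_eq, Nat.choose_symm_half]
      have h' : (2 * n + 1 : ℂ) * n.centralBinom = d * (n + 1) := by exact_mod_cast h
      have h1 : (d : ℂ) ≠ 0 := by exact_mod_cast hd0.ne'
      have h2 : (2 * n + 1 : ℂ) ≠ 0 := by exact_mod_cast (Nat.succ_ne_zero (2 * n))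
      push_cast
      rw [inv_mul_eq_div, div_eq_div_iff h1 h2]
      linear_combination h'
    · simp
  exact ⟨d, _, hd0, Fock.irreduciblyCovariant he hr hn, le_superNorm_two_two hd0 hκ horth,
    superNorm_top_one_le hd0 hκ.le horth (Fock.sum_smul_mul_conjTranspose he hr hn)⟩

theorem proposition4p5 :
    (∀ ε : ℝ, 0 < ε → ∃ (n : ℕ) (Φ : Superoperator n), 0 < n ∧ Φ ≠ 0 ∧
      IrreduciblyCovariant Φ ∧ superNorm 2 2 Φ ≥ (2 - ε) * superNorm ∞ 1 Φ) ∧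
    (∀ C : ℝ, (∀ (n : ℕ) (Φ : Superoperator n), 0 < n → IrreduciblyCovariant Φ →
      superNorm 2 2 Φ ≤ C * superNorm ∞ 1 Φ) → 2 ≤ C) := by
  constructor
  · intro ε hε
    -- The inequality `(2 - ε) κ ≤ 1` amounts to `1 ≤ ε (n + 1)`.
    obtain ⟨n, hn⟩ := exists_nat_gt ε⁻¹
    obtain ⟨d, Φ, hd, hΦ, h1, h2⟩ := exists_irreduciblyCovariant n
    have hκ : (0 : ℝ) < (n + 1 : ℝ) / (2 * n + 1) := by positivity
    refine ⟨d, Φ, hd, ?_, hΦ, ?_⟩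
    · rintro rfl
      have h0 : superNorm 2 2 (0 : Superoperator d) ≤ 0 := by
        refine Real.sSup_le ?_ le_rfl
        rintro r ⟨X, Y, -, -, rfl⟩
        simp [matInner]
      linarith
    · have h3 : (2 - ε) * ((n + 1 : ℝ) / (2 * n + 1)) ≤ 1 := by
        rw [inv_lt_iff_one_lt_mul₀ hε] at hn
        rw [mul_div_assoc', div_le_one (by positivity)]
        nlinarith
      rcases le_or_gt (2 - ε) 0 with h | h
      · exact (mul_nonpos_of_nonpos_of_nonneg h (superNorm_nonneg _ _ _)).trans
          (superNorm_nonneg _ _ _)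
      · calc (2 - ε) * superNorm ∞ 1 Φ
            ≤ (2 - ε) * ((n + 1 : ℝ) / (2 * n + 1)) ^ 2 := by gcongr
          _ = (2 - ε) * ((n + 1 : ℝ) / (2 * n + 1)) * ((n + 1 : ℝ) / (2 * n + 1)) := by ring
          _ ≤ 1 * ((n + 1 : ℝ) / (2 * n + 1)) := by gcongr
          _ ≤ superNorm 2 2 Φ := by rw [one_mul]; exact h1
  · intro C hC
    by_contra! hC2
    -- The assumed bound forces `1 ≤ C κ`, that is `(2 - C)(n + 1) ≤ 1`, contradicting this choice.
    obtain ⟨n, hn⟩ := exists_nat_gt (2 - C)⁻¹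
    obtain ⟨d, Φ, hd, hΦ, h1, h2⟩ := exists_irreduciblyCovariant n
    have hκ : (0 : ℝ) < (n + 1 : ℝ) / (2 * n + 1) := by positivity
    have h := h1.trans (hC d Φ hd hΦ)
    have hC0 : 0 < C := by
      by_contra! h0
      have := mul_nonpos_of_nonpos_of_nonneg h0 (superNorm_nonneg ∞ 1 Φ)
      linarith
    have h3 : (n + 1 : ℝ) / (2 * n + 1) ≤ C * ((n + 1 : ℝ) / (2 * n + 1)) ^ 2 :=
      h.trans (by gcongr)
    have h4 : 1 ≤ C * ((n + 1 : ℝ) / (2 * n + 1)) := by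
      refine le_of_mul_le_mul_right ?_ hκ
      linarith
    rw [mul_div_assoc', one_le_div (by positivity)] at h4
    rw [inv_lt_iff_one_lt_mul₀ (by linarith)] at hn
    nlinarith
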